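/- Let $s=\{s_{m,n}\}_{m,n\in\mathbb Z_+}$ be complex numbers such that $$\sum_{m,n,m',n'\in\mathbb Z_+}\alpha_{m,n}\overline{\alpha_{m',n'}}\,s_{m+m',n+n'}\ge 0$$ for all finitely supported complex families $(\alpha_{m,n})$. A (nonnegative) Borel measure $\mu$ on $\mathbb R^2$ *solves the two-dimensional moment problem* for $s$ if $\int_{\mathbb R^2}x_1^mx_2^n\,d\mu=s_{m,n}$ for all $m,n\in\mathbb Z_+$ (all integrals existing). Let $$\Omega=\{(m,k,l;n,r,t):m,n\in\mathbb Z_+,\ k,l,r,t\in\mathbb Z\},\qquad \Omega'=\{(m,k,l;n,r,t)\in\Omega:(k,l,r,t)\ne(0,0,0,0)\},$$ and let $w:\mathbb N\to\Omega'$ be any bijection, $\mathbb N=\{1,2,\dots\}$. For $u:\Omega\to\mathbb C$, a Borel measure $\mu$ on $\mathbb R^2$ *solves the extended problem with moments* $u$ if, for all $(m,k,l;n,r,t)\in\Omega$ (all integrals existing), $$\int_{\mathbb R^2}x_1^m(x_1+i)^k(x_1-i)^l\,x_2^n(x_2+i)^r(x_2-i)^t\,d\mu=u_{m,k,l;n,r,t}.$$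 Let $\mathcal H=\mathcal H_0\oplus\bigoplus_{j\ge1}\mathcal H_j$ be a Hilbert space orthogonal direct sum, where $\mathcal H_0$ is a complex Hilbert space and each $\mathcal H_j$, $j\ge1$, is one-dimensional. Let $e_j\in\mathcal H_j$ be unit vectors ($j\ge 1$), and let $h_{m,n}\in\mathcal H_0$ ($m,n\in\mathbb Z_+$) satisfy $(h_{m,n},h_{m',n'})=s_{m+m',n+n'}$ for all $m,n,m',n'$. (Scalar products are linear in the first argument.) **Theorem 3.2.** The two-dimensional moment problem for $s$ has a solution if and only if there is a family $\{h_{m,k,l;n,r,t}\}_{(m,k,l;n,r,t)\in\Omega}$ in $\mathcal H$ such that: 1. $h_{m,0,0;n,0,0}=h_{m,n}$ for all $m,n\in\mathbb Z_+$; 2. for some subset $\Lambda\subset\mathbb N$ and every $r\in\mathbb N$: $h_{w(r)}\in\mathcal H_0\oplus\bigoplus_{j\in\Lambda,\ j\le r}\mathcal H_j$ and $(h_{w(r)},e_r)\ge0$; 3. for all $(m,k,l;n,r,t)\in\Omega$, $$h_{m+1,k,l;n,r,t}+ih_{m,k,l;n,r,t}=h_{m,k+1,l;n,r,t},\qquad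 h_{m+1,k,l;n,r,t}-ih_{m,k,l;n,r,t}=h_{m,k,l+1;n,r,t},$$ $$h_{m,k,l;n+1,r,t}+ih_{m,k,l;n,r,t}=h_{m,k,l;n,r+1,t},\qquad h_{m,k,l;n+1,r,t}-ih_{m,k,l;n,r,t}=h_{m,k,l;n,r,t+1};$$ 4. there is a function $\varphi:\Omega\to\mathbb C$ such that for all $(m,k,l;n,r,t),(m',k',l';n',r',t')\in\Omega$, $$(h_{m,k,l;n,r,t},h_{m',k',l';n',r',t'})=\varphi(m+m',k+l',l+k';n+n',r+t',t+r').$$ Moreover, for every family with properties 1–4 and $\varphi$ as in 4, the extended problem with moments $\varphi$ has exactly one solution, and this measure solves the two-dimensional moment problem for $s$. -/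

import Mathlib

open MeasureTheory Complex
open scoped ComplexOrder

noncomputable section

namespace TwoDimMoment

/-- The index set `Ω` of all `(m, k, l; n, r, t)` with `m, n ∈ ℤ₊` and `k, l, r, t ∈ ℤ`. -/
@[ext]
structure Idx where
  m : ℕ
  k : ℤ
  l : ℤ
  n : ℕ
  r : ℤ
  t : ℤ

/-- The set `Ω₀` of indices `(m, 0, 0; n, 0, 0)`. -/
def Omega0 : Set Idx := {a | a.k = 0 ∧ a.l = 0 ∧ a.r = 0 ∧ a.t = 0}

/-- The "sum" of the indices `(m, k, l; n, r, t)` and `(m', k', l'; n', r', t')`, namely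
`(m + m', k + l', l + k'; n + n', r + t', t + r')`; the exchange of the roles of `x + i` and
`x - i` in the second index reflects complex conjugation. -/
def sumIdx (a b : Idx) : Idx :=
  ⟨a.m + b.m, a.k + b.l, a.l + b.k, a.n + b.n, a.r + b.t, a.t + b.r⟩

/-- The function `x₁^m (x₁+i)^k (x₁-i)^l x₂^n (x₂+i)^r (x₂-i)^t` on the plane. -/
def extMonomial (a : Idx) (x : ℝ × ℝ) : ℂ :=
  (x.1 : ℂ) ^ a.m * ((x.1 : ℂ) + I) ^ a.k * ((x.1 : ℂ) - I) ^ a.l *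
    (x.2 : ℂ) ^ a.n * ((x.2 : ℂ) + I) ^ a.r * ((x.2 : ℂ) - I) ^ a.t

/-- The (nonnegative Borel) measure `μ` on the plane solves the two-dimensional moment problem
with moments `s`: all moments exist and `∫ x₁^m x₂^n dμ = s m n`. -/
def IsSolution (s : ℕ → ℕ → ℂ) (μ : Measure (ℝ × ℝ)) : Prop :=
  ∀ m n : ℕ, Integrable (fun x : ℝ × ℝ => (x.1 : ℂ) ^ m * (x.2 : ℂ) ^ n) μ ∧
    ∫ x : ℝ × ℝ, (x.1 : ℂ) ^ m * (x.2 : ℂ) ^ n ∂μ = s m n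

/-- The measure `μ` solves the extended two-dimensional moment problem with moments `u`. -/
def IsExtSolution (u : Idx → ℂ) (μ : Measure (ℝ × ℝ)) : Prop :=
  ∀ a : Idx, Integrable (extMonomial a) μ ∧ ∫ x, extMonomial a x ∂μ = u a

/-- Positivity: `∑ α_{m,n} conj(α_{m',n'}) s_{m+m',n+n'} ≥ 0` (in particular, real) for every
finitely supported complex family `α`. -/
def IsPositive (s : ℕ → ℕ → ℂ) : Prop :=
  ∀ α : ℕ × ℕ →₀ ℂ,
    0 ≤ ∑ p ∈ α.support, ∑ q ∈ α.support,
      α p * (starRingEnd ℂ) (α q) * s (p.1 + q.1) (p.2 + q.2)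

variable {H : Type*} [NormedAddCommGroup H] [InnerProductSpace ℂ H]

/-- `H` is the Hilbert space direct sum of a Hilbert space `V 0` and one-dimensional subspaces
`V 1, V 2, …`. -/
structure IsModelSpace [CompleteSpace H] (V : ℕ → Submodule ℂ H) : Prop where
  complete_zero : IsComplete (V 0 : Set H)
  finrank_eq_one : ∀ j : ℕ, 1 ≤ j → Module.finrank ℂ (V j) = 1
  isHilbertSum : IsHilbertSum ℂ (fun j => V j) (fun j => (V j).subtypeₗᵢ)

/-- `(h_{m,n}, h_{m',n'}) = s_{m+m',n+n'}`. The scalar product `(x, y)`, linear in `x`, is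
`inner ℂ y x` in Mathlib. -/
def Represents (s : ℕ → ℕ → ℂ) (h : ℕ → ℕ → H) : Prop :=
  ∀ m n m' n' : ℕ, inner ℂ (h m' n') (h m n) = s (m + m') (n + n')

/-- `g` extends the family `h`: `g_{m,0,0;n,0,0} = h_{m,n}`. -/
def Extends (h : ℕ → ℕ → H) (g : Idx → H) : Prop :=
  ∀ m n : ℕ, g ⟨m, 0, 0, n, 0, 0⟩ = h m n

/-- Triangular position: for some set `Λ` of positive integers and all `r ≥ 1`, the vector
`g_{w(r)}` lies in `V 0 ⊕ ⨁_{j ∈ Λ, j ≤ r} V j`, and `(g_{w(r)}, e_r) ≥ 0`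
(in particular, it is real). -/
def IsTriangular (V : ℕ → Submodule ℂ H) (e : ℕ+ → H) (w : ℕ+ ≃ (Omega0ᶜ : Set Idx))
    (g : Idx → H) : Prop :=
  ∃ Λ : Set ℕ+, ∀ r : ℕ+,
    g (w r) ∈ V 0 ⊔ (⨆ j ∈ {j : ℕ+ | j ∈ Λ ∧ j ≤ r}, V j) ∧
    0 ≤ inner ℂ (e r) (g (w r))

/-- The four shift relations, which express that raising `k`, `l`, `r`, `t` by one amounts to
multiplication by `x₁ + i`, `x₁ - i`, `x₂ + i`, `x₂ - i`, respectively. -/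
structure ShiftRelations (g : Idx → H) : Prop where
  shift_k : ∀ (m : ℕ) (k l : ℤ) (n : ℕ) (r t : ℤ),
    g ⟨m + 1, k, l, n, r, t⟩ + I • g ⟨m, k, l, n, r, t⟩ = g ⟨m, k + 1, l, n, r, t⟩
  shift_l : ∀ (m : ℕ) (k l : ℤ) (n : ℕ) (r t : ℤ),
    g ⟨m + 1, k, l, n, r, t⟩ - I • g ⟨m, k, l, n, r, t⟩ = g ⟨m, k, l + 1, n, r, t⟩
  shift_r : ∀ (m : ℕ) (k l : ℤ) (n : ℕ) (r t : ℤ),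
    g ⟨m, k, l, n + 1, r, t⟩ + I • g ⟨m, k, l, n, r, t⟩ = g ⟨m, k, l, n, r + 1, t⟩
  shift_t : ∀ (m : ℕ) (k l : ℤ) (n : ℕ) (r t : ℤ),
    g ⟨m, k, l, n + 1, r, t⟩ - I • g ⟨m, k, l, n, r, t⟩ = g ⟨m, k, l, n, r, t + 1⟩

/-- The Gram matrix of `g` is given by the function `φ` of the "sum" index:
`(g_a, g_b) = φ (sumIdx a b)`. -/
def HasGram (g : Idx → H) (φ : Idx → ℂ) : Prop :=
  ∀ a b : Idx, inner ℂ (g b) (g a) = φ (sumIdx a b)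

end TwoDimMoment

end

open TwoDimMoment

/-! Necessity. A solution `μ` integrates every extended monomial, since `(x ± i)^k` is dominated by
a power of `1 + x²`. The extended monomials thus form a family in `L²(μ)` with the required shift
relations and Gram function. An isometry on their span carries them into `H`: it sends `x₁^m x₂^n`
to `h m n`, and the `r`-th Gram–Schmidt vector of the components orthogonal to all `x₁^m x₂^n` to `e
r`, when that vector is nonzero; `Λ` records these `r` (`exists_triangular`).

Sufficiency. On the span of `g` the shift of `m` is a symmetric operator, and the shift relations
provide its resolvent at `-i`: it lowers `k` by one and is a contraction. Together with its analogue
for `n` this yields bounded commuting normal operators `R`, `S` (`exists_resolvent_pair`). Gelfand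
duality and the Riesz theorem give joint spectral measures on `ℂ × ℂ`, concentrated where each
coordinate is `0` or of the form `(x + i)⁻¹` with `x` real. Write `g₀` for the vector with zero
index. The solution is the image of its measure under `z ↦ Re z⁻¹` in each coordinate. Since `g₀ =
R^N S^M v` with `v` again in the family, that measure has density `|z₁^N z₂^M|²` with respect to the
measure of `v`; this factor removes the spurious value `0` and makes the unbounded moments finite
(`exists_isExtSolution`).

Uniqueness. The star algebra generated by `(x₁ + i)⁻¹` and `(x₂ + i)⁻¹` separates points and lies in
the span of the bounded extended monomials, whose integrals are prescribed (`IsExtSolution.unique`).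
-/

noncomputable section

namespace TwoDimMoment

/-! ### Operators determined by their action on a family of vectors -/

section Families

variable {ι E F : Type*} [NormedAddCommGroup E] [InnerProductSpace ℂ E]
  [NormedAddCommGroup F] [InnerProductSpace ℂ F]

/-- The closed linear span of a family of vectors. -/
def closedSpan (f : ι → E) : Submodule ℂ E :=
  (Submodule.span ℂ (Set.range f)).topologicalClosure

lemma mem_closedSpan (f : ι → E) (a : ι) : f a ∈ closedSpan f :=
  Submodule.le_topologicalClosure _ (Submodule.subset_span ⟨a, rfl⟩)

lemma closedSpan_le {f : ι → E} {K : Submodule ℂ E} (hK : IsClosed (K : Set E))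
    (h : ∀ a, f a ∈ K) : closedSpan f ≤ K :=
  Submodule.topologicalClosure_minimal _
    (Submodule.span_le.2 (by rintro _ ⟨a, rfl⟩; exact h a)) hK

instance [CompleteSpace E] (f : ι → E) : CompleteSpace (closedSpan f) :=
  (Submodule.isClosed_topologicalClosure _).completeSpace_coe

lemma mem_orthogonal_closedSpan {f : ι → E} {x : E} (h : ∀ a, inner ℂ (f a) x = 0) :
    x ∈ (closedSpan f)ᗮ := by
  rw [closedSpan, Submodule.orthogonal_closure, Submodule.mem_orthogonal]
  intro u hu
  induction hu using Submodule.span_induction with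
  | mem x hx => obtain ⟨a, rfl⟩ := hx; exact h a
  | zero => simp
  | add x y _ _ hx hy => simp [inner_add_left, hx, hy]
  | smul c x _ hx => simp [inner_smul_left, hx]

lemma eq_of_mem_closedSpan {f : ι → E} {x y : E} (hx : x ∈ closedSpan f) (hy : y ∈ closedSpan f)
    (h : ∀ a, inner ℂ (f a) x = inner ℂ (f a) y) : x = y := by
  have h1 : x - y ∈ (closedSpan f)ᗮ :=
    mem_orthogonal_closedSpan fun a => by rw [inner_sub_right, h a, sub_self]
  have h2 := (Submodule.mem_orthogonal _ _).1 h1 _ (sub_mem hx hy)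
  exact sub_eq_zero.1 (inner_self_eq_zero.1 h2)

/-- Bounded operators that agree on a family and vanish on its orthogonal complement agree. -/
lemma clm_ext_of_closedSpan [CompleteSpace E] {f : ι → E} {S T : E →L[ℂ] F}
    (h : ∀ a, S (f a) = T (f a)) (hS : ∀ x ∈ (closedSpan f)ᗮ, S x = 0)
    (hT : ∀ x ∈ (closedSpan f)ᗮ, T x = 0) : S = T := by
  have key : closedSpan f ≤ LinearMap.ker (S - T).toLinearMap :=
    closedSpan_le (S - T).isClosed_ker fun a => by simp [h a]
  ext x
  obtain ⟨y, hy, z, hz, rfl⟩ := (closedSpan f).exists_add_mem_mem_orthogonal x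
  have := key hy
  simp only [LinearMap.mem_ker, ContinuousLinearMap.coe_coe, sub_apply,
    sub_eq_zero] at this
  rw [map_add, map_add, hS z hz, hT z hz, this]

/-- A norm-decreasing correspondence between two families extends to a bounded operator. -/
lemma exists_clm_of_norm_le [CompleteSpace E] [CompleteSpace F] (f : ι → E) (g : ι → F)
    (h : ∀ c : ι →₀ ℂ, ‖Finsupp.linearCombination ℂ g c‖ ≤ ‖Finsupp.linearCombination ℂ f c‖) :
    ∃ T : E →L[ℂ] F, (∀ a, T (f a) = g a) ∧ (∀ x ∈ (closedSpan f)ᗮ, T x = 0) ∧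
      ∀ x, T x ∈ closedSpan g := by
  have hmem : ∀ c, Finsupp.linearCombination ℂ f c ∈ closedSpan f := fun c =>
    Submodule.le_topologicalClosure _ (by
      rw [← Finsupp.range_linearCombination]; exact ⟨c, rfl⟩)
  let e : (ι →₀ ℂ) →ₗ[ℂ] closedSpan f := (Finsupp.linearCombination ℂ f).codRestrict _ hmem
  have he : DenseRange e := by
    intro x
    rw [closure_subtype, ← Set.range_comp]
    have : Set.range (Subtype.val ∘ e) = (Submodule.span ℂ (Set.range f) : Set E) := by
      rw [← Finsupp.range_linearCombination]; rfl
    rw [this]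
    exact x.2
  -- The norm inequality makes the map on combinations well defined and bounded, so it extends by
  -- continuity; composing with the projection makes it zero on the complement.
  let T₀ : closedSpan f →L[ℂ] F := (Finsupp.linearCombination ℂ g).extendOfNorm e
  have hT₀ : ∀ c, T₀ (e c) = Finsupp.linearCombination ℂ g c := fun c =>
    LinearMap.extendOfNorm_eq he ⟨1, fun c => by rw [one_mul]; exact h c⟩ c
  have hval : ∀ a, T₀.comp (closedSpan f).orthogonalProjectionOnto (f a) = g a := fun a => by
    have h1 : (closedSpan f).orthogonalProjectionOnto (f a) = e (Finsupp.single a 1) := by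
      ext
      rw [← Submodule.starProjection_apply,
        Submodule.starProjection_eq_self_iff.2 (mem_closedSpan f a)]
      simp [e]
    rw [ContinuousLinearMap.comp_apply, h1, hT₀]
    simp
  have hzero : ∀ x ∈ (closedSpan f)ᗮ, T₀.comp (closedSpan f).orthogonalProjectionOnto x = 0 := by
    intro x hx
    rw [ContinuousLinearMap.comp_apply,
      Submodule.orthogonalProjectionOnto_apply_of_mem_orthogonal hx, map_zero]
  refine ⟨T₀.comp (closedSpan f).orthogonalProjectionOnto, hval, hzero, fun x => ?_⟩
  obtain ⟨y, hy, z, hz, rfl⟩ := (closedSpan f).exists_add_mem_mem_orthogonal x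
  rw [map_add, hzero z hz, add_zero]
  have hcl : IsClosed (((closedSpan g).comap
      (T₀.comp (closedSpan f).orthogonalProjectionOnto).toLinearMap : Submodule ℂ E) : Set E) :=
    (Submodule.isClosed_topologicalClosure _).preimage
      (T₀.comp (closedSpan f).orthogonalProjectionOnto).continuous
  exact closedSpan_le hcl (fun a => by
    rw [Submodule.mem_comap]
    exact (hval a).symm ▸ mem_closedSpan g a) hy

/-- Families with equal Gram matrices have equal inner products of linear combinations. -/
lemma inner_linearCombination_eq {f : ι → E} {g : ι → F}
    (h : ∀ a b, inner ℂ (f a) (f b) = inner ℂ (g a) (g b)) (c d : ι →₀ ℂ) :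
    inner ℂ (Finsupp.linearCombination ℂ f c) (Finsupp.linearCombination ℂ f d) =
      inner ℂ (Finsupp.linearCombination ℂ g c) (Finsupp.linearCombination ℂ g d) := by
  simp only [Finsupp.linearCombination_apply, Finsupp.sum, sum_inner, inner_sum, inner_smul_left,
    inner_smul_right, h]

lemma norm_linearCombination_eq {f : ι → E} {g : ι → F}
    (h : ∀ a b, inner ℂ (f a) (f b) = inner ℂ (g a) (g b)) (c : ι →₀ ℂ) :
    ‖Finsupp.linearCombination ℂ f c‖ = ‖Finsupp.linearCombination ℂ g c‖ := by
  rw [@norm_eq_sqrt_re_inner ℂ, @norm_eq_sqrt_re_inner ℂ, inner_linearCombination_eq h]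

/-- If `τ` is a symmetric shift, then `(τ + i)⁻¹` extends to a bounded operator. -/
lemma exists_resolvent [CompleteSpace E] {g : ι → E} {τ σ : ι → ι}
    (hτ : ∀ a b, inner ℂ (g (τ a)) (g b) = inner ℂ (g a) (g (τ b)))
    (hσ : ∀ a, g (τ (σ a)) + I • g (σ a) = g a) :
    ∃ R : E →L[ℂ] E, (∀ a, R (g a) = g (σ a)) ∧ (∀ x ∈ (closedSpan g)ᗮ, R x = 0) ∧
      ∀ x, R x ∈ closedSpan g := by
  obtain ⟨R, h1, h2, h3⟩ := exists_clm_of_norm_le g (g ∘ σ) fun c => by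
    set v := Finsupp.linearCombination ℂ (g ∘ σ) c with hv
    set u := Finsupp.linearCombination ℂ (g ∘ τ ∘ σ) c with hu
    have hg : Finsupp.linearCombination ℂ g c = u + I • v := by
      simp only [hu, hv, Finsupp.linearCombination_apply, Finsupp.sum, Finset.smul_sum,
        ← Finset.sum_add_distrib]
      refine Finset.sum_congr rfl fun a _ => ?_
      rw [← hσ a, smul_add, smul_comm I]
      simp only [Function.comp]
    -- Symmetry of the shift makes `⟨u, v⟩` real, hence `‖u + i v‖² = ‖u‖² + ‖v‖² ≥ ‖v‖²`.
    have hsym : inner ℂ u v = inner ℂ v u := by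
      simp only [hu, hv, Finsupp.linearCombination_apply, Finsupp.sum, sum_inner, inner_sum,
        inner_smul_left, inner_smul_right, Function.comp, hτ]
    have hre : RCLike.re (inner ℂ u (I • v)) = 0 := by
      have hc : (starRingEnd ℂ) (inner ℂ u v) = inner ℂ u v := by
        rw [inner_conj_symm, hsym]
      rw [inner_smul_right]
      have := Complex.conj_eq_iff_im.1 hc
      simp [this]
    rw [hg]
    have hn := @norm_add_sq ℂ _ _ _ _ u (I • v)
    rw [hre, norm_smul, norm_I, one_mul] at hn
    refine le_of_sq_le_sq ?_ (norm_nonneg _)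
    nlinarith [sq_nonneg ‖u‖]
  exact ⟨R, h1, h2, fun x => closedSpan_le (Submodule.isClosed_topologicalClosure _)
    (fun a => mem_closedSpan g (σ a)) (h3 x)⟩

/-- The adjoint of an operator that acts on a family by a map of indices. -/
lemma adjoint_apply_of_gram [CompleteSpace E] {g : ι → E} {σ σ' : ι → ι} {R : E →L[ℂ] E}
    (hR : ∀ a, R (g a) = g (σ a)) (h0 : ∀ x ∈ (closedSpan g)ᗮ, R x = 0)
    (hσ : ∀ a b, inner ℂ (g (σ a)) (g b) = inner ℂ (g a) (g (σ' b))) (a : ι) :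
    ContinuousLinearMap.adjoint R (g a) = g (σ' a) := by
  refine eq_of_mem_closedSpan ?_ (mem_closedSpan g _) fun b => ?_
  -- The range of the adjoint is orthogonal to the kernel of `R`, which contains the complement of
  -- the closed span.
  · rw [← (closedSpan g).orthogonal_orthogonal]
    intro x hx
    rw [ContinuousLinearMap.adjoint_inner_right, h0 x hx, inner_zero_left]
  · rw [ContinuousLinearMap.adjoint_inner_right, hR, hσ]

lemma adjoint_apply_eq_zero [CompleteSpace E] {K : Submodule ℂ E} {R : E →L[ℂ] E}
    (hR : ∀ x, R x ∈ K) {x : E} (hx : x ∈ Kᗮ) : ContinuousLinearMap.adjoint R x = 0 := by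
  rw [← @inner_self_eq_zero ℂ, ContinuousLinearMap.adjoint_inner_right]
  exact hx _ (hR _)

end Families

/-! ### Joint functional calculus and scalar spectral measures -/

section Calculus

variable {H : Type*} [NormedAddCommGroup H] [InnerProductSpace ℂ H] [CompleteSpace H]

/-- A real continuous function, regarded as a complex one. -/
def ofRealMap {X : Type*} [TopologicalSpace X] (f : C(X, ℝ)) : C(X, ℂ) :=
  ⟨fun x => (f x : ℂ), by fun_prop⟩

lemma inner_starAlgHom_star_mul_self {A : Type*} [Semiring A] [Algebra ℂ A] [Star A]
    (Ψ : A →⋆ₐ[ℂ] (H →L[ℂ] H)) (a b : A) (v : H) :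
    inner ℂ v (Ψ (star a * b) v) = inner ℂ (Ψ a v) (Ψ b v) := by
  rw [map_mul, map_star, ContinuousLinearMap.star_eq_adjoint, mul_apply_eq_comp,
    ContinuousLinearMap.adjoint_inner_right]

/-- A real function is its own star, so its image is self-adjoint and has real quadratic form. -/
lemma inner_ofRealMap {X : Type*} [TopologicalSpace X]
    (Ψ : C(X, ℂ) →⋆ₐ[ℂ] (H →L[ℂ] H)) (v : H) (f : C(X, ℝ)) :
    ((inner ℂ v (Ψ (ofRealMap f) v)).re : ℂ) = inner ℂ v (Ψ (ofRealMap f) v) := by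
  have h1 : star (ofRealMap f) = ofRealMap f := by
    ext x; simp [ofRealMap]
  refine Complex.conj_eq_iff_re.1 ?_
  rw [inner_conj_symm, ← ContinuousLinearMap.adjoint_inner_right,
    ← ContinuousLinearMap.star_eq_adjoint, ← map_star, h1]

/-- The scalar spectral measure of a representation of `C(X, ℂ)`, `X` compact. -/
lemma exists_measure_of_starAlgHom {X : Type*} [TopologicalSpace X] [CompactSpace X] [T2Space X]
    [MeasurableSpace X] [BorelSpace X] (Ψ : C(X, ℂ) →⋆ₐ[ℂ] (H →L[ℂ] H)) (v : H) :
    ∃ ν : Measure X, IsFiniteMeasure ν ∧ ∀ f : C(X, ℂ), ∫ x, f x ∂ν = inner ℂ v (Ψ f v) := by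
  let L : CompactlySupportedContinuousMap X ℝ →ₗ[ℝ] ℝ :=
    { toFun := fun f => (inner ℂ v (Ψ (ofRealMap f) v)).re
      map_add' := fun f g => by
        have : ofRealMap ((f + g : CompactlySupportedContinuousMap X ℝ) : C(X, ℝ)) =
            ofRealMap f + ofRealMap g := by ext x; simp [ofRealMap]
        rw [this, map_add, add_apply, inner_add_right, add_re]
      map_smul' := fun c f => by
        have : ofRealMap ((c • f : CompactlySupportedContinuousMap X ℝ) : C(X, ℝ)) =
            (c : ℂ) • ofRealMap f := by ext x; simp [ofRealMap]
        rw [this, map_smul, smul_apply, inner_smul_right, re_ofReal_mul]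
        rfl }
  have hL : ∀ f, 0 ≤ f → 0 ≤ L f := by
    intro f hf
    -- With `q = √f` the functional at `f` becomes `‖Ψ q v‖²`.
    let q : C(X, ℝ) := ⟨fun x => √(f x), by fun_prop⟩
    have h1 : star (ofRealMap q) * ofRealMap q = ofRealMap f := by
      ext x
      simp only [ofRealMap, q, ContinuousMap.mul_apply, ContinuousMap.star_apply,
        ContinuousMap.coe_mk, RCLike.star_def, conj_ofReal, ← ofReal_mul]
      rw [Real.mul_self_sqrt (hf x)]
    change 0 ≤ (inner ℂ v (Ψ (ofRealMap f) v)).re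
    rw [← h1, inner_starAlgHom_star_mul_self]
    exact inner_self_nonneg (𝕜 := ℂ)
  let ν := RealRMK.rieszMeasure (PositiveLinearMap.mk₀ L hL)
  have hν : IsFiniteMeasure ν := by
    dsimp [ν, RealRMK.rieszMeasure]
    infer_instance
  have hint : ∀ f : C(X, ℝ), ((∫ x, f x ∂ν : ℝ) : ℂ) = inner ℂ v (Ψ (ofRealMap f) v) := by
    intro f
    rw [← inner_ofRealMap]
    congr 1
    exact RealRMK.integral_rieszMeasure (PositiveLinearMap.mk₀ L hL)
      (CompactlySupportedContinuousMap.continuousMapEquiv f)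
  refine ⟨ν, hν, fun f => ?_⟩
  let f₁ : C(X, ℝ) := ⟨fun x => (f x).re, by fun_prop⟩
  let f₂ : C(X, ℝ) := ⟨fun x => (f x).im, by fun_prop⟩
  have hf : f = ofRealMap f₁ + I • ofRealMap f₂ := by
    ext x
    simp [ofRealMap, f₁, f₂, mul_comm I, re_add_im]
  have hfi : Integrable f ν :=
    f.continuous.integrable_of_hasCompactSupport (HasCompactSupport.of_compactSpace _)
  have h3 := integral_re_add_im hfi
  simp only [RCLike.re_to_complex, RCLike.im_to_complex, RCLike.I_to_complex] at h3
  rw [← h3, hf, map_add, map_smul, add_apply, smul_apply, inner_add_right, inner_smul_right,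
    ← hint, ← hint, ← hf]
  simp only [f₁, f₂, ContinuousMap.coe_mk, mul_comm I]
  rfl

/-- A joint functional calculus for two commuting normal elements of a commutative algebra, with
scalar spectral measures. -/
lemma exists_calculus_of_comm {A : Type*} [CommCStarAlgebra A] (π : A →⋆ₐ[ℂ] (H →L[ℂ] H))
    (a b : A) :
    ∃ Φ : C(ℂ × ℂ, ℂ) →⋆ₐ[ℂ] (H →L[ℂ] H), Φ ⟨Prod.fst, continuous_fst⟩ = π a ∧
      Φ ⟨Prod.snd, continuous_snd⟩ = π b ∧
      ∀ v : H, ∃ ν : Measure (ℂ × ℂ), IsFiniteMeasure ν ∧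
        ∀ f : C(ℂ × ℂ, ℂ), Integrable f ν ∧ ∫ z, f z ∂ν = inner ℂ v (Φ f v) := by
  let X := WeakDual.characterSpace ℂ A
  let G := gelfandStarTransform A
  let Ψ : C(X, ℂ) →⋆ₐ[ℂ] (H →L[ℂ] H) := π.comp (G.symm : C(X, ℂ) →⋆ₐ[ℂ] A)
  -- The joint spectrum is the image of the character space under `p`. It is compact, so every
  -- continuous function is integrable for the pushed-forward measure.
  let p : C(X, ℂ × ℂ) := ⟨fun χ => (G a χ, G b χ), by fun_prop⟩
  refine ⟨Ψ.comp (ContinuousMap.compStarAlgHom' ℂ ℂ p), ?_, ?_, fun v => ?_⟩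
  · have : ContinuousMap.compStarAlgHom' ℂ ℂ p ⟨Prod.fst, continuous_fst⟩ = G a := by
      ext χ; rfl
    simp only [StarAlgHom.comp_apply, this, Ψ]
    exact congrArg π (G.symm_apply_apply a)
  · have : ContinuousMap.compStarAlgHom' ℂ ℂ p ⟨Prod.snd, continuous_snd⟩ = G b := by
      ext χ; rfl
    simp only [StarAlgHom.comp_apply, this, Ψ]
    exact congrArg π (G.symm_apply_apply b)
  · let _ : MeasurableSpace X := borel X
    have : BorelSpace X := ⟨rfl⟩
    obtain ⟨ν, hν, h⟩ := exists_measure_of_starAlgHom Ψ v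
    have hp : Measurable p := p.continuous.measurable
    refine ⟨ν.map p, inferInstance, fun f => ⟨?_, ?_⟩⟩
    · rw [integrable_map_measure f.continuous.aestronglyMeasurable hp.aemeasurable]
      exact (f.comp p).continuous.integrable_of_hasCompactSupport
        (HasCompactSupport.of_compactSpace _)
    · rw [integral_map hp.aemeasurable f.continuous.aestronglyMeasurable]
      exact h (f.comp p)

/-- The joint functional calculus of two commuting normal operators. -/
lemma exists_calculus (R S : H →L[ℂ] H) (hR : Commute R (star R)) (hS : Commute S (star S))
    (hRS : Commute R S) (hRS' : Commute R (star S)) :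
    ∃ Φ : C(ℂ × ℂ, ℂ) →⋆ₐ[ℂ] (H →L[ℂ] H), Φ ⟨Prod.fst, continuous_fst⟩ = R ∧
      Φ ⟨Prod.snd, continuous_snd⟩ = S ∧
      ∀ v : H, ∃ ν : Measure (ℂ × ℂ), IsFiniteMeasure ν ∧
        ∀ f : C(ℂ × ℂ, ℂ), Integrable f ν ∧ ∫ z, f z ∂ν = inner ℂ v (Φ f v) := by
  let B : StarSubalgebra ℂ (H →L[ℂ] H) := StarAlgebra.adjoin ℂ {R, S}
  have hRS'' : Commute S (star R) := by simpa using (hRS'.star_star).symm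
  have hB : IsMulCommutative B := StarAlgebra.isMulCommutative_adjoin ℂ
    (by
      rintro x (rfl | rfl) y (rfl | rfl)
      exacts [rfl, hRS, hRS.symm, rfl])
    (by
      rintro x (rfl | rfl) y (rfl | rfl)
      exacts [hR, hRS', hRS'', hS])
  have : IsClosed (B.topologicalClosure : Set (H →L[ℂ] H)) := B.isClosed_topologicalClosure
  let _ : CommCStarAlgebra B.topologicalClosure :=
    { StarSubalgebra.cstarAlgebra B.topologicalClosure with
      mul_comm := (B.commRingTopologicalClosure fun x y => mul_comm' x y).mul_comm }
  have hRm : R ∈ B.topologicalClosure :=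
    B.le_topologicalClosure (StarAlgebra.subset_adjoin ℂ _ (by simp))
  have hSm : S ∈ B.topologicalClosure :=
    B.le_topologicalClosure (StarAlgebra.subset_adjoin ℂ _ (by simp))
  exact exists_calculus_of_comm (A := B.topologicalClosure) B.topologicalClosure.subtype
    ⟨R, hRm⟩ ⟨S, hSm⟩

end Calculus

/-! ### Existence for the extended problem -/

section Existence

variable {H : Type*} [NormedAddCommGroup H] [InnerProductSpace ℂ H]

lemma HasGram.inner_eq_inner {g : Idx → H} {φ : Idx → ℂ} (hg : HasGram g φ) {a b c d : Idx}
    (h : sumIdx b a = sumIdx d c) : inner ℂ (g a) (g b) = inner ℂ (g c) (g d) := by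
  rw [hg, hg, h]

/-- Thus linear relations among the vectors `g a` pass to `φ`. -/
lemma HasGram.apply_eq_inner {g : Idx → H} {φ : Idx → ℂ} (hg : HasGram g φ) (a : Idx) :
    φ a = inner ℂ (g ⟨0, 0, 0, 0, 0, 0⟩) (g a) := by
  rw [hg]
  congr 1
  ext <;> simp [sumIdx]

/-- Writing `x₁ = (x₁ + i) - i` trades a power of `x₁` for powers of `x₁ + i`, which allows
induction on `m`. -/
lemma extMonomial_succ_m (m : ℕ) (k l : ℤ) (n : ℕ) (r t : ℤ) (x : ℝ × ℝ) :
    extMonomial ⟨m + 1, k, l, n, r, t⟩ x =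
      extMonomial ⟨m, k + 1, l, n, r, t⟩ x - I * extMonomial ⟨m, k, l, n, r, t⟩ x := by
  have h : (x.1 : ℂ) + I ≠ 0 := fun h => by simpa using congrArg Complex.im h
  simp only [extMonomial, zpow_add_one₀ h, pow_succ]
  ring

lemma extMonomial_succ_n (m : ℕ) (k l : ℤ) (n : ℕ) (r t : ℤ) (x : ℝ × ℝ) :
    extMonomial ⟨m, k, l, n + 1, r, t⟩ x =
      extMonomial ⟨m, k, l, n, r + 1, t⟩ x - I * extMonomial ⟨m, k, l, n, r, t⟩ x := by
  have h : (x.2 : ℂ) + I ≠ 0 := fun h => by simpa using congrArg Complex.im h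
  simp only [extMonomial, zpow_add_one₀ h, pow_succ]
  ring

/-- By the shift relations, it suffices to consider the moments with `m = n = 0`. -/
lemma isExtSolution_of_zero {g : Idx → H} {φ : Idx → ℂ} (hs : ShiftRelations g)
    (hg : HasGram g φ) {μ : Measure (ℝ × ℝ)}
    (h : ∀ k l r t, Integrable (extMonomial ⟨0, k, l, 0, r, t⟩) μ ∧
      ∫ x, extMonomial ⟨0, k, l, 0, r, t⟩ x ∂μ = φ ⟨0, k, l, 0, r, t⟩) : IsExtSolution φ μ := by
  have h1 : ∀ (m : ℕ) (k l r t : ℤ), Integrable (extMonomial ⟨m, k, l, 0, r, t⟩) μ ∧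
      ∫ x, extMonomial ⟨m, k, l, 0, r, t⟩ x ∂μ = φ ⟨m, k, l, 0, r, t⟩ := by
    intro m
    induction m with
    | zero => exact h
    | succ m ih =>
      intro k l r t
      have e : extMonomial ⟨m + 1, k, l, 0, r, t⟩ = fun x =>
          extMonomial ⟨m, k + 1, l, 0, r, t⟩ x - I * extMonomial ⟨m, k, l, 0, r, t⟩ x :=
        funext fun x => extMonomial_succ_m ..
      rw [e]
      refine ⟨(ih _ _ _ _).1.sub ((ih _ _ _ _).1.const_mul I), ?_⟩
      rw [integral_sub (ih _ _ _ _).1 ((ih _ _ _ _).1.const_mul I), integral_const_mul,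
        (ih _ _ _ _).2, (ih _ _ _ _).2]
      simp only [hg.apply_eq_inner]
      rw [← hs.shift_k, inner_add_right, inner_smul_right]
      ring
  rintro ⟨m, k, l, n, r, t⟩
  induction n generalizing r with
  | zero => exact h1 ..
  | succ n ih =>
    have e : extMonomial ⟨m, k, l, n + 1, r, t⟩ = fun x =>
        extMonomial ⟨m, k, l, n, r + 1, t⟩ x - I * extMonomial ⟨m, k, l, n, r, t⟩ x :=
      funext fun x => extMonomial_succ_n ..
    rw [e]
    refine ⟨(ih _).1.sub ((ih _).1.const_mul I), ?_⟩
    rw [integral_sub (ih _).1 ((ih _).1.const_mul I), integral_const_mul, (ih _).2, (ih _).2]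
    simp only [hg.apply_eq_inner]
    rw [← hs.shift_r, inner_add_right, inner_smul_right]
    ring

variable [CompleteSpace H]

/-- The bounded operators `(x₁ + i)⁻¹` and `(x₂ + i)⁻¹` on the space spanned by the family. -/
lemma exists_resolvent_pair {g : Idx → H} {φ : Idx → ℂ} (hs : ShiftRelations g)
    (hg : HasGram g φ) :
    ∃ R S : H →L[ℂ] H,
      (∀ m k l n r t, R (g ⟨m, k, l, n, r, t⟩) = g ⟨m, k - 1, l, n, r, t⟩) ∧
      (∀ m k l n r t, star R (g ⟨m, k, l, n, r, t⟩) = g ⟨m, k, l - 1, n, r, t⟩) ∧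
      (∀ m k l n r t, S (g ⟨m, k, l, n, r, t⟩) = g ⟨m, k, l, n, r - 1, t⟩) ∧
      (∀ m k l n r t, star S (g ⟨m, k, l, n, r, t⟩) = g ⟨m, k, l, n, r, t - 1⟩) ∧
      Commute R (star R) ∧ Commute S (star S) ∧ Commute R S ∧ Commute R (star S) ∧
      R - star R + (2 * I) • (R * star R) = 0 ∧ S - star S + (2 * I) • (S * star S) = 0 := by
  obtain ⟨R, hR, hR0, hRm⟩ := exists_resolvent (g := g)
    (τ := fun a => ⟨a.m + 1, a.k, a.l, a.n, a.r, a.t⟩)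
    (σ := fun a => ⟨a.m, a.k - 1, a.l, a.n, a.r, a.t⟩)
    (fun a b => hg.inner_eq_inner (by ext <;> simp [sumIdx]; ring))
    (fun a => by simpa using hs.shift_k a.m (a.k - 1) a.l a.n a.r a.t)
  obtain ⟨S, hS, hS0, hSm⟩ := exists_resolvent (g := g)
    (τ := fun a => ⟨a.m, a.k, a.l, a.n + 1, a.r, a.t⟩)
    (σ := fun a => ⟨a.m, a.k, a.l, a.n, a.r - 1, a.t⟩)
    (fun a b => hg.inner_eq_inner (by ext <;> simp [sumIdx]; ring))
    (fun a => by simpa using hs.shift_r a.m a.k a.l a.n (a.r - 1) a.t)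
  have hR' := adjoint_apply_of_gram hR hR0
    (σ' := fun a => ⟨a.m, a.k, a.l - 1, a.n, a.r, a.t⟩)
    (fun a b => hg.inner_eq_inner (by ext <;> simp [sumIdx]; ring))
  have hS' := adjoint_apply_of_gram hS hS0
    (σ' := fun a => ⟨a.m, a.k, a.l, a.n, a.r, a.t - 1⟩)
    (fun a b => hg.inner_eq_inner (by ext <;> simp [sumIdx]; ring))
  have hR0' : ∀ x ∈ (closedSpan g)ᗮ, ContinuousLinearMap.adjoint R x = 0 :=
    fun x hx => adjoint_apply_eq_zero hRm hx
  have hS0' : ∀ x ∈ (closedSpan g)ᗮ, ContinuousLinearMap.adjoint S x = 0 :=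
    fun x hx => adjoint_apply_eq_zero hSm hx
  refine ⟨R, S, fun m k l n r t => hR _, fun m k l n r t => hR' _, fun m k l n r t => hS _,
    fun m k l n r t => hS' _, ?_, ?_, ?_, ?_, ?_, ?_⟩
  · exact clm_ext_of_closedSpan (f := g)
      (fun a => by simp [ContinuousLinearMap.star_eq_adjoint, hR, hR'])
      (fun x hx => by simp [ContinuousLinearMap.star_eq_adjoint, hR0' x hx])
      (fun x hx => by simp [hR0 x hx])
  · exact clm_ext_of_closedSpan (f := g)
      (fun a => by simp [ContinuousLinearMap.star_eq_adjoint, hS, hS'])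
      (fun x hx => by simp [ContinuousLinearMap.star_eq_adjoint, hS0' x hx])
      (fun x hx => by simp [hS0 x hx])
  · exact clm_ext_of_closedSpan (f := g) (fun a => by simp [hR, hS])
      (fun x hx => by simp [hS0 x hx]) (fun x hx => by simp [hR0 x hx])
  · exact clm_ext_of_closedSpan (f := g)
      (fun a => by simp [ContinuousLinearMap.star_eq_adjoint, hR, hS'])
      (fun x hx => by simp [ContinuousLinearMap.star_eq_adjoint, hS0' x hx])
      (fun x hx => by simp [hR0 x hx])
  · refine clm_ext_of_closedSpan (f := g) (fun a => ?_)
      (fun x hx => by simp [ContinuousLinearMap.star_eq_adjoint, hR0 x hx, hR0' x hx])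
      (fun x hx => rfl)
    -- The difference of the two relations is the resolvent identity: `R* g_a - R g_a = 2i R R*
    -- g_a`.
    have h1 := hs.shift_k a.m (a.k - 1) (a.l - 1) a.n a.r a.t
    have h2 := hs.shift_l a.m (a.k - 1) (a.l - 1) a.n a.r a.t
    simp only [sub_add_cancel] at h1 h2
    simp only [ContinuousLinearMap.star_eq_adjoint, add_apply, sub_apply, smul_apply,
      mul_apply_eq_comp, hR, hR', zero_apply]
    rw [← h1, ← h2]
    module
  · refine clm_ext_of_closedSpan (f := g) (fun a => ?_)
      (fun x hx => by simp [ContinuousLinearMap.star_eq_adjoint, hS0 x hx, hS0' x hx])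
      (fun x hx => rfl)
    have h1 := hs.shift_r a.m a.k a.l a.n (a.r - 1) (a.t - 1)
    have h2 := hs.shift_t a.m a.k a.l a.n (a.r - 1) (a.t - 1)
    simp only [sub_add_cancel] at h1 h2
    simp only [ContinuousLinearMap.star_eq_adjoint, add_apply, sub_apply, smul_apply,
      mul_apply_eq_comp, hS, hS', zero_apply]
    rw [← h1, ← h2]
    module

/-- If `z = (x + i)⁻¹` with `x` real, or `z = 0`, then multiplication by a high power of `|z|²`
turns `(x + i)^k (x - i)^l` into a polynomial in `z` and its conjugate. -/
lemma normSq_pow_mul_zpow {z : ℂ} (hz : z - star z + 2 * I * (z * star z) = 0) {N p q : ℕ}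
    (hN : N ≠ 0) (hp : p ≠ 0) :
    (z ^ N * star z ^ N) * ((((z⁻¹).re : ℂ) + I) ^ ((N : ℤ) - p) *
      (((z⁻¹).re : ℂ) - I) ^ ((N : ℤ) - q)) = z ^ p * star z ^ q := by
  rcases eq_or_ne z 0 with rfl | h0
  · simp [hN, hp]
  have h0' : star z ≠ 0 := star_ne_zero.2 h0
  -- So `z⁻¹` has imaginary part `1`, i.e. `z⁻¹ = x + i` with `x` its real part.
  have h1 : z⁻¹ - (star z)⁻¹ = 2 * I := by
    field_simp
    linear_combination -hz
  have hc : (starRingEnd ℂ) z⁻¹ = (star z)⁻¹ := by rw [map_inv₀]; rfl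
  have hre : (((z⁻¹).re : ℝ) : ℂ) = (z⁻¹ + (star z)⁻¹) / 2 := by
    rw [re_eq_add_conj, hc]
  have e1 : (((z⁻¹).re : ℝ) : ℂ) + I = z⁻¹ := by rw [hre]; linear_combination -h1 / 2
  have e2 : (((z⁻¹).re : ℝ) : ℂ) - I = (star z)⁻¹ := by rw [hre]; linear_combination h1 / 2
  rw [e1, e2, zpow_sub₀ (inv_ne_zero h0), zpow_sub₀ (inv_ne_zero h0')]
  simp only [zpow_natCast, inv_pow]
  field_simp

section SpectralMeasure

variable {Φ : C(ℂ × ℂ, ℂ) →⋆ₐ[ℂ] (H →L[ℂ] H)} {ν : H → Measure (ℂ × ℂ)}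

/-- Functions annihilated by the functional calculus vanish almost everywhere. -/
lemma ae_eq_zero_of_calculus_eq_zero
    (hν : ∀ v, ∀ f : C(ℂ × ℂ, ℂ), Integrable f (ν v) ∧ ∫ z, f z ∂(ν v) = inner ℂ v (Φ f v))
    {f : C(ℂ × ℂ, ℂ)} (hf : Φ f = 0) (v : H) : ∀ᵐ z ∂(ν v), f z = 0 := by
  have h1 := hν v (star f * f)
  have h2 : ∀ z, (star f * f) z = ((‖f z‖ ^ 2 : ℝ) : ℂ) := fun z => by
    simp only [ContinuousMap.mul_apply, ContinuousMap.star_apply, RCLike.star_def, conj_mul']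
    push_cast
    rfl
  have h3 : Integrable (fun z => ‖f z‖ ^ 2) (ν v) := by
    have := h1.1.re
    refine this.congr (Filter.Eventually.of_forall fun z => ?_)
    simp only [h2]
    exact ofReal_re _
  -- The integral of `|f|²` is `‖Φ f v‖²`.
  have h4 : ∫ z, ‖f z‖ ^ 2 ∂(ν v) = 0 := by
    have := h1.2
    simp only [h2] at this
    rw [integral_complex_ofReal, inner_starAlgHom_star_mul_self, hf] at this
    simpa using this
  have h5 := (integral_eq_zero_iff_of_nonneg (fun z => by positivity) h3).1 h4
  filter_upwards [h5] with z hz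
  simpa using hz

/-- The scalar spectral measure of `Φ f v` has density `|f|²` with respect to that of `v`. -/
lemma spectral_measure_eq_withDensity (hfin : ∀ v, IsFiniteMeasure (ν v))
    (hν : ∀ v, ∀ f : C(ℂ × ℂ, ℂ), Integrable f (ν v) ∧ ∫ z, f z ∂(ν v) = inner ℂ v (Φ f v))
    (f : C(ℂ × ℂ, ℂ)) (v : H) :
    ν (Φ f v) = (ν v).withDensity (fun z => ((‖f z‖₊ ^ 2 : NNReal) : ENNReal)) := by
  have hmeas : Measurable fun z => ‖f z‖₊ ^ 2 := by fun_prop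
  have h2 : ∀ z, (star f * f) z = ((‖f z‖ ^ 2 : ℝ) : ℂ) := fun z => by
    simp only [ContinuousMap.mul_apply, ContinuousMap.star_apply, RCLike.star_def, conj_mul']
    push_cast
    rfl
  have h3 : Integrable (fun z => ‖f z‖ ^ 2) (ν v) := by
    have := (hν v (star f * f)).1.re
    refine this.congr (Filter.Eventually.of_forall fun z => ?_)
    simp only [h2]
    exact ofReal_re _
  have : IsFiniteMeasure ((ν v).withDensity (fun z => ((‖f z‖₊ ^ 2 : NNReal) : ENNReal))) := by
    refine isFiniteMeasure_withDensity ?_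
    have := h3.2
    rw [hasFiniteIntegral_iff_enorm] at this
    refine (lt_of_eq_of_lt ?_ this).ne
    refine lintegral_congr fun z => ?_
    rw [enorm_eq_nnnorm]
    norm_cast
    ext
    simp
  -- For a test function `h` both integrals equal `⟨Φ f v, Φ h Φ f v⟩`.
  refine ext_of_forall_integral_eq_of_IsFiniteMeasure fun h => ?_
  let h' : C(ℂ × ℂ, ℂ) := ofRealMap h.toContinuousMap
  have e1 := (hν (Φ f v) h').2
  have e2 := (hν v (star f * (h' * f))).2
  rw [inner_starAlgHom_star_mul_self, map_mul, mul_apply_eq_comp] at e2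
  rw [← e2] at e1
  rw [integral_withDensity_eq_integral_smul hmeas]
  have e3 : ∀ z, (star f * (h' * f)) z = ((‖f z‖₊ ^ 2 • h z : ℝ) : ℂ) := fun z => by
    have := h2 z
    simp only [ContinuousMap.mul_apply] at this ⊢
    rw [mul_left_comm, this, NNReal.smul_def, smul_eq_mul, mul_comm]
    push_cast
    rfl
  simp only [e3] at e1
  change ∫ z, ((h z : ℝ) : ℂ) ∂(ν (Φ f v)) = _ at e1
  rw [integral_complex_ofReal, integral_complex_ofReal] at e1
  exact_mod_cast e1

end SpectralMeasure

/-- The extended moment problem has a solution for the Gram function of a family that satisfies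
the shift relations. -/
lemma exists_isExtSolution {g : Idx → H} {φ : Idx → ℂ} (hs : ShiftRelations g)
    (hg : HasGram g φ) : ∃ μ : Measure (ℝ × ℝ), IsExtSolution φ μ := by
  obtain ⟨R, S, hR, hR', hS, hS', c1, c2, c3, c4, hRz, hSz⟩ := exists_resolvent_pair hs hg
  obtain ⟨Φ, hΦR, hΦS, h⟩ := exists_calculus R S c1 c2 c3 c4
  choose ν hfin hν using h
  let f₁ : C(ℂ × ℂ, ℂ) := ⟨Prod.fst, continuous_fst⟩
  let f₂ : C(ℂ × ℂ, ℂ) := ⟨Prod.snd, continuous_snd⟩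
  have hz₁ : ∀ v, ∀ᵐ z ∂(ν v), z.1 - star z.1 + 2 * I * (z.1 * star z.1) = 0 := fun v =>
    ae_eq_zero_of_calculus_eq_zero hν (f := f₁ - star f₁ + (2 * I) • (f₁ * star f₁))
      (by simp only [map_add, map_sub, map_smul, map_mul, map_star, f₁, hΦR, hRz]) v
  have hz₂ : ∀ v, ∀ᵐ z ∂(ν v), z.2 - star z.2 + 2 * I * (z.2 * star z.2) = 0 := fun v =>
    ae_eq_zero_of_calculus_eq_zero hν (f := f₂ - star f₂ + (2 * I) • (f₂ * star f₂))
      (by simp only [map_add, map_sub, map_smul, map_mul, map_star, f₂, hΦS, hSz]) v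
  have pR : ∀ (p : ℕ) m k l n r t,
      (R ^ p) (g ⟨m, k, l, n, r, t⟩) = g ⟨m, k - p, l, n, r, t⟩ := by
    intro p
    induction p with
    | zero => simp
    | succ p ih => intro m k l n r t; rw [pow_succ, mul_apply_eq_comp, hR, ih]; grind
  have pR' : ∀ (p : ℕ) m k l n r t,
      (star R ^ p) (g ⟨m, k, l, n, r, t⟩) = g ⟨m, k, l - p, n, r, t⟩ := by
    intro p
    induction p with
    | zero => simp
    | succ p ih => intro m k l n r t; rw [pow_succ, mul_apply_eq_comp, hR', ih]; grind
  have pS : ∀ (p : ℕ) m k l n r t,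
      (S ^ p) (g ⟨m, k, l, n, r, t⟩) = g ⟨m, k, l, n, r - p, t⟩ := by
    intro p
    induction p with
    | zero => simp
    | succ p ih => intro m k l n r t; rw [pow_succ, mul_apply_eq_comp, hS, ih]; grind
  have pS' : ∀ (p : ℕ) m k l n r t,
      (star S ^ p) (g ⟨m, k, l, n, r, t⟩) = g ⟨m, k, l, n, r, t - p⟩ := by
    intro p
    induction p with
    | zero => simp
    | succ p ih => intro m k l n r t; rw [pow_succ, mul_apply_eq_comp, hS', ih]; grind
  -- A left inverse of `x ↦ (x + i)⁻¹` in each coordinate. The convention `0⁻¹ = 0` is harmless,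
  -- since the density below vanishes there.
  let T : ℂ × ℂ → ℝ × ℝ := fun z => ((z.1⁻¹).re, (z.2⁻¹).re)
  have hT : Measurable T := by fun_prop
  refine ⟨(ν (g ⟨0, 0, 0, 0, 0, 0⟩)).map T, isExtSolution_of_zero hs hg fun k l r t => ?_⟩
  -- `N` exceeds `|k|` and `|l|`, so that `|z|^(2N)` cancels all poles at `z = 0`; `N` and `p` are
  -- nonzero so that both sides vanish at that point.
  obtain ⟨N, p, q, hN, hp, rfl, rfl⟩ : ∃ N p q : ℕ, N ≠ 0 ∧ p ≠ 0 ∧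
      k = (N : ℤ) - p ∧ l = (N : ℤ) - q :=
    ⟨k.natAbs + l.natAbs + 1, (k.natAbs + l.natAbs + 1 - k).toNat,
      (k.natAbs + l.natAbs + 1 - l).toNat, by omega, by omega, by omega, by omega⟩
  obtain ⟨M, p', q', hM, hp', rfl, rfl⟩ : ∃ N p q : ℕ, N ≠ 0 ∧ p ≠ 0 ∧
      r = (N : ℤ) - p ∧ t = (N : ℤ) - q :=
    ⟨r.natAbs + t.natAbs + 1, (r.natAbs + t.natAbs + 1 - r).toNat,
      (r.natAbs + t.natAbs + 1 - t).toNat, by omega, by omega, by omega, by omega⟩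
  set a : Idx := ⟨0, (N : ℤ) - p, (N : ℤ) - q, 0, (M : ℤ) - p', (M : ℤ) - q'⟩ with ha
  let v : H := g ⟨0, N, 0, 0, M, 0⟩
  let f : C(ℂ × ℂ, ℂ) := f₁ ^ N * f₂ ^ M
  let G : C(ℂ × ℂ, ℂ) := f₁ ^ p * star f₁ ^ q * (f₂ ^ p' * star f₂ ^ q')
  have hv : g ⟨0, 0, 0, 0, 0, 0⟩ = Φ f v := by
    simp only [f, f₁, f₂, v, map_mul, map_pow, hΦR, hΦS, mul_apply_eq_comp, pR, pS, sub_self]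
  have hG : Φ G v = g ⟨0, (N : ℤ) - p, -q, 0, (M : ℤ) - p', -q'⟩ := by
    simp only [G, f₁, f₂, v, map_mul, map_pow, map_star, hΦR, hΦS, mul_apply_eq_comp, pR, pS,
      pR', pS', zero_sub]
  have hae : ∀ᵐ z ∂(ν v), (‖f z‖₊ ^ 2 : NNReal) • extMonomial a (T z) = G z := by
    filter_upwards [hz₁ v, hz₂ v] with z h1 h2
    have e1 := normSq_pow_mul_zpow (q := q) h1 hN hp
    have e2 := normSq_pow_mul_zpow (q := q') h2 hM hp'
    have e3 : (((‖f z‖₊ ^ 2 : NNReal) : ℝ) : ℂ) =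
        (z.1 ^ N * star z.1 ^ N) * (z.2 ^ M * star z.2 ^ M) := by
      have : (((‖f z‖₊ ^ 2 : NNReal) : ℝ) : ℂ) = f z * star (f z) := by
        rw [RCLike.star_def, mul_conj']; push_cast; rfl
      rw [this]
      change z.1 ^ N * z.2 ^ M * star (z.1 ^ N * z.2 ^ M) = _
      rw [star_mul, star_pow, star_pow]
      ring
    rw [NNReal.smul_def, Complex.real_smul, e3]
    change _ = z.1 ^ p * star z.1 ^ q * (z.2 ^ p' * star z.2 ^ q')
    rw [← e1, ← e2]
    simp only [extMonomial, ha, T, pow_zero, one_mul, mul_one]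
    ring
  have hmeas : Measurable fun z => ‖f z‖₊ ^ 2 := by fun_prop
  have ham : Measurable (extMonomial a) := by
    unfold extMonomial
    fun_prop
  have hden := spectral_measure_eq_withDensity hfin hν f v
  rw [← hv] at hden
  constructor
  · rw [integrable_map_measure ham.aestronglyMeasurable hT.aemeasurable, hden,
      integrable_withDensity_iff_integrable_smul hmeas]
    exact (hν v G).1.congr (hae.mono fun z hz => hz.symm)
  · rw [integral_map hT.aemeasurable ham.aestronglyMeasurable, hden,
      integral_withDensity_eq_integral_smul hmeas, integral_congr_ae hae, (hν v G).2, hG, hg]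
    -- Pairing with `v` exchanges its exponents, which adds the missing `N` to `-q` and `M` to
    -- `-q'`.
    congr 1
    ext <;> simp [sumIdx, ha] <;> ring

end Existence

/-! ### Determinacy of the extended problem -/

section Uniqueness

lemma ofReal_add_I_ne_zero (x : ℝ) : (x : ℂ) + I ≠ 0 :=
  fun h => by simpa using congrArg Complex.im h

lemma ofReal_sub_I_ne_zero (x : ℝ) : (x : ℂ) - I ≠ 0 :=
  fun h => by simpa using congrArg Complex.im h

lemma continuous_extMonomial (a : Idx) : Continuous (extMonomial a) := by
  unfold extMonomial
  have h1 : Continuous fun x : ℝ × ℝ => ((x.1 : ℂ) + I) ^ a.k :=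
    Continuous.zpow₀ (by fun_prop) _ fun x => Or.inl (ofReal_add_I_ne_zero x.1)
  have h2 : Continuous fun x : ℝ × ℝ => ((x.1 : ℂ) - I) ^ a.l :=
    Continuous.zpow₀ (by fun_prop) _ fun x => Or.inl (ofReal_sub_I_ne_zero x.1)
  have h3 : Continuous fun x : ℝ × ℝ => ((x.2 : ℂ) + I) ^ a.r :=
    Continuous.zpow₀ (by fun_prop) _ fun x => Or.inl (ofReal_add_I_ne_zero x.2)
  have h4 : Continuous fun x : ℝ × ℝ => ((x.2 : ℂ) - I) ^ a.t :=
    Continuous.zpow₀ (by fun_prop) _ fun x => Or.inl (ofReal_sub_I_ne_zero x.2)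
  fun_prop

lemma extMonomial_zero (x : ℝ × ℝ) : extMonomial ⟨0, 0, 0, 0, 0, 0⟩ x = 1 := by
  simp [extMonomial]

lemma conj_extMonomial (a : Idx) (x : ℝ × ℝ) :
    (starRingEnd ℂ) (extMonomial a x) = extMonomial ⟨a.m, a.l, a.k, a.n, a.t, a.r⟩ x := by
  simp only [extMonomial, map_mul, map_pow, map_zpow₀, map_add, map_sub, conj_ofReal, conj_I,
    sub_neg_eq_add, ← sub_eq_add_neg]
  ring

lemma extMonomial_mul_conj (a b : Idx) (x : ℝ × ℝ) :
    extMonomial a x * (starRingEnd ℂ) (extMonomial b x) = extMonomial (sumIdx a b) x := by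
  rw [conj_extMonomial]
  simp only [extMonomial, sumIdx, pow_add, zpow_add₀ (ofReal_add_I_ne_zero _),
    zpow_add₀ (ofReal_sub_I_ne_zero _)]
  ring

lemma one_le_norm_ofReal_add_I (x : ℝ) : 1 ≤ ‖(x : ℂ) + I‖ := by
  have := abs_im_le_norm ((x : ℂ) + I)
  simpa using this

/-- `(x₁ + i)⁻¹` as a bounded continuous function. -/
def resolventFst : BoundedContinuousFunction (ℝ × ℝ) ℂ :=
  BoundedContinuousFunction.ofNormedAddCommGroup (extMonomial ⟨0, -1, 0, 0, 0, 0⟩)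
    (continuous_extMonomial _) 1 fun x => by
      simpa [extMonomial] using inv_le_one_of_one_le₀ (one_le_norm_ofReal_add_I x.1)

/-- `(x₂ + i)⁻¹` as a bounded continuous function. -/
def resolventSnd : BoundedContinuousFunction (ℝ × ℝ) ℂ :=
  BoundedContinuousFunction.ofNormedAddCommGroup (extMonomial ⟨0, 0, 0, 0, -1, 0⟩)
    (continuous_extMonomial _) 1 fun x => by
      simpa [extMonomial] using inv_le_one_of_one_le₀ (one_le_norm_ofReal_add_I x.2)

/-- The bounded functions among the extended monomials. -/
def boundedMonomials : Set (BoundedContinuousFunction (ℝ × ℝ) ℂ) :=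
  {f | ∃ a, ∀ x, f x = extMonomial a x}

/-- The bounded monomials contain `1` and are stable under products and conjugation, so their span
is already a star algebra. -/
lemma adjoin_resolvents_le_span {f : BoundedContinuousFunction (ℝ × ℝ) ℂ}
    (hf : f ∈ StarAlgebra.adjoin ℂ {resolventFst, resolventSnd}) :
    f ∈ Submodule.span ℂ boundedMonomials := by
  induction hf using StarAlgebra.adjoin_induction with
  | mem f hf =>
    apply Submodule.subset_span
    rcases hf with rfl | rfl
    exacts [⟨_, fun x => rfl⟩, ⟨_, fun x => rfl⟩]
  | algebraMap c =>
    rw [Algebra.algebraMap_eq_smul_one]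
    exact Submodule.smul_mem _ _ (Submodule.subset_span
      ⟨⟨0, 0, 0, 0, 0, 0⟩, fun x => by rw [extMonomial_zero]; rfl⟩)
  | add f g _ _ hf hg => exact add_mem hf hg
  | mul f g _ _ hf hg =>
    have h := Submodule.mul_mem_mul hf hg
    rw [Submodule.span_mul_span] at h
    refine Submodule.span_mono ?_ h
    rintro _ ⟨f, ⟨a, ha⟩, g, ⟨b, hb⟩, rfl⟩
    refine ⟨sumIdx a ⟨b.m, b.l, b.k, b.n, b.t, b.r⟩, fun x => ?_⟩
    rw [← extMonomial_mul_conj, conj_extMonomial, ← ha, ← hb]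
    rfl
  | star f hfm hf =>
    clear hfm
    induction hf using Submodule.span_induction with
    | mem f hf =>
      obtain ⟨a, ha⟩ := hf
      refine Submodule.subset_span ⟨⟨a.m, a.l, a.k, a.n, a.t, a.r⟩, fun x => ?_⟩
      rw [← conj_extMonomial, ← ha]
      rfl
    | zero => simp
    | add f g _ _ hf hg => rw [star_add]; exact add_mem hf hg
    | smul c f _ hf => rw [star_smul]; exact Submodule.smul_mem _ _ hf

/-- A solution of the extended moment problem is a finite measure. -/
lemma IsExtSolution.isFiniteMeasure {u : Idx → ℂ} {μ : Measure (ℝ × ℝ)}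
    (h : IsExtSolution u μ) : IsFiniteMeasure μ := by
  have h1 := (h ⟨0, 0, 0, 0, 0, 0⟩).1
  have h2 : extMonomial ⟨0, 0, 0, 0, 0, 0⟩ = fun _ => 1 := funext extMonomial_zero
  rw [h2, integrable_const_iff] at h1
  simpa using h1

/-- The extended moment problem is determinate. -/
lemma IsExtSolution.unique {u : Idx → ℂ} {μ μ' : Measure (ℝ × ℝ)}
    (h : IsExtSolution u μ) (h' : IsExtSolution u μ') : μ = μ' := by
  have := h.isFiniteMeasure
  have := h'.isFiniteMeasure
  refine ext_of_forall_mem_subalgebra_integral_eq_of_pseudoEMetric_complete_countable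
    (A := StarAlgebra.adjoin ℂ {resolventFst, resolventSnd}) ?_ fun f hf => ?_
  · intro x y hxy
    have hmem₁ : resolventFst ∈ StarAlgebra.adjoin ℂ {resolventFst, resolventSnd} :=
      StarAlgebra.subset_adjoin ℂ _ (by simp)
    have hmem₂ : resolventSnd ∈ StarAlgebra.adjoin ℂ {resolventFst, resolventSnd} :=
      StarAlgebra.subset_adjoin ℂ _ (by simp)
    by_cases h1 : x.1 = y.1
    · have h2 : x.2 ≠ y.2 := fun h2 => hxy (Prod.ext h1 h2)
      refine ⟨_, ⟨_, ⟨resolventSnd, hmem₂, rfl⟩, rfl⟩, fun heq => h2 ?_⟩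
      change extMonomial _ x = extMonomial _ y at heq
      simpa [extMonomial] using heq
    · refine ⟨_, ⟨_, ⟨resolventFst, hmem₁, rfl⟩, rfl⟩, fun heq => h1 ?_⟩
      change extMonomial _ x = extMonomial _ y at heq
      simpa [extMonomial] using heq
  · have hint : ∀ (ν : Measure (ℝ × ℝ)) [IsFiniteMeasure ν]
        (f : BoundedContinuousFunction (ℝ × ℝ) ℂ), Integrable f ν := fun ν _ f => f.integrable ν
    have hf' := adjoin_resolvents_le_span hf
    clear hf
    induction hf' using Submodule.span_induction with
    | mem f hf =>
      obtain ⟨a, ha⟩ := hf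
      simp only [ha, (h a).2, (h' a).2]
    | zero => simp
    | add f g _ _ hf hg =>
      simp only [BoundedContinuousFunction.coe_add, Pi.add_apply]
      rw [integral_add (hint _ f) (hint _ g), integral_add (hint _ f) (hint _ g), hf, hg]
    | smul c f _ hf =>
      simp only [BoundedContinuousFunction.coe_smul]
      rw [integral_smul, integral_smul, hf]

end Uniqueness

/-! ### Gram–Schmidt and isometries into the model space -/

/-- Each vector pairs nonnegatively with the corresponding Gram–Schmidt vector. -/
lemma inner_gramSchmidtNormed_self_nonneg {E : Type*} [NormedAddCommGroup E]
    [InnerProductSpace ℂ E] (u : ℕ+ → E) (r : ℕ+) :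
    0 ≤ inner ℂ (InnerProductSpace.gramSchmidtNormed ℂ u r) (u r) := by
  have h : inner ℂ (InnerProductSpace.gramSchmidt ℂ u r) (u r) =
      inner ℂ (InnerProductSpace.gramSchmidt ℂ u r) (InnerProductSpace.gramSchmidt ℂ u r) := by
    conv_lhs => rw [InnerProductSpace.gramSchmidt_def'' ℂ u r]
    rw [inner_add_right, inner_sum, Finset.sum_eq_zero, add_zero]
    intro i hi
    rw [inner_smul_right,
      InnerProductSpace.gramSchmidt_orthogonal ℂ u (Finset.mem_Iio.1 hi).ne', mul_zero]
  rw [InnerProductSpace.gramSchmidtNormed, inner_smul_left, h, inner_self_eq_norm_sq_to_K]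
  simp only [map_inv₀, RCLike.conj_ofReal]
  norm_cast
  change (0 : ℂ) ≤ ((_ : ℝ) : ℂ)
  rw [zero_le_real]
  positivity

section Isometry

variable {ι E F : Type*} [NormedAddCommGroup E] [InnerProductSpace ℂ E] [CompleteSpace E]
  [NormedAddCommGroup F] [InnerProductSpace ℂ F] [CompleteSpace F]

/-- Two families with the same Gram matrix are related by a partial isometry. -/
lemma exists_isometry_of_gram (f : ι → E) (g : ι → F)
    (h : ∀ a b, inner ℂ (f a) (f b) = inner ℂ (g a) (g b)) :
    ∃ T : E →L[ℂ] F, (∀ a, T (f a) = g a) ∧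
      ∀ x, ∀ y ∈ closedSpan f, inner ℂ (T x) (T y) = inner ℂ x y := by
  obtain ⟨T, hT, hT0, -⟩ := exists_clm_of_norm_le f g fun c => (norm_linearCombination_eq h c).ge
  refine ⟨T, hT, fun x y hy => ?_⟩
  -- `T* T` is the identity on the closed span, so only one of the two arguments has to lie there.
  have key : closedSpan f ≤ LinearMap.ker
      ((ContinuousLinearMap.adjoint T).comp T - ContinuousLinearMap.id ℂ E).toLinearMap := by
    refine closedSpan_le (ContinuousLinearMap.isClosed_ker _) fun a => ?_
    rw [LinearMap.mem_ker, ContinuousLinearMap.coe_coe, sub_apply,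
      ContinuousLinearMap.comp_apply, ContinuousLinearMap.id_apply, sub_eq_zero]
    refine eq_of_mem_closedSpan ?_ (mem_closedSpan f a) fun b => ?_
    · rw [← (closedSpan f).orthogonal_orthogonal]
      intro z hz
      rw [ContinuousLinearMap.adjoint_inner_right, hT0 z hz, inner_zero_left]
    · rw [ContinuousLinearMap.adjoint_inner_right, hT, hT, h]
  have := key hy
  rw [LinearMap.mem_ker, ContinuousLinearMap.coe_coe, sub_apply,
    ContinuousLinearMap.comp_apply, ContinuousLinearMap.id_apply, sub_eq_zero] at this
  rw [← ContinuousLinearMap.adjoint_inner_right, this]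

end Isometry

section Triangular

variable {κ L H : Type*} [NormedAddCommGroup L] [InnerProductSpace ℂ L] [CompleteSpace L]
  [NormedAddCommGroup H] [InnerProductSpace ℂ H] [CompleteSpace H]

open InnerProductSpace in
/-- A sequence in a Hilbert space can be moved into triangular position by an isometry that is
prescribed on a given family. -/
lemma exists_triangular {V : ℕ → Submodule ℂ H} (hV : IsModelSpace V) {e : ℕ+ → H}
    (he_mem : ∀ j : ℕ+, e j ∈ V j) (he_norm : ∀ j : ℕ+, ‖e j‖ = 1) (f : κ → L) (h : κ → H)
    (h_mem : ∀ k, h k ∈ V 0) (hfh : ∀ a b, inner ℂ (f a) (f b) = inner ℂ (h a) (h b))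
    (u : ℕ+ → L) :
    ∃ T : L →L[ℂ] H, (∀ k, T (f k) = h k) ∧
      (∃ Λ : Set ℕ+, ∀ r : ℕ+, T (u r) ∈ V 0 ⊔ (⨆ j ∈ {j : ℕ+ | j ∈ Λ ∧ j ≤ r}, V j) ∧
        0 ≤ inner ℂ (e r) (T (u r))) ∧
      ∃ K : Submodule ℂ L, (∀ k, f k ∈ K) ∧ (∀ r, u r ∈ K) ∧
        ∀ x, ∀ y ∈ K, inner ℂ (T x) (T y) = inner ℂ x y := by
  classical
  have hVorth : ∀ {i j : ℕ}, i ≠ j → ∀ {x y : H}, x ∈ V i → y ∈ V j → inner ℂ x y = 0 :=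
    fun hij x y hx hy => hV.isHilbertSum.OrthogonalFamily hij ⟨x, hx⟩ ⟨y, hy⟩
  let P := (closedSpan f).starProjection
  let ρ : ℕ+ → L := fun r => u r - P (u r)
  have hP : ∀ x, P x ∈ closedSpan f := fun x => Submodule.starProjection_apply_mem _ x
  have hρ : ∀ r, ρ r ∈ (closedSpan f)ᗮ := fun r => Submodule.sub_starProjection_mem_orthogonal _
  let û : ℕ+ → L := gramSchmidtNormed ℂ ρ
  -- The normalized vector `û r` is `0` when `ρ r` depends on its predecessors; `ê r` must then
  -- vanish too for the Gram matrices to agree.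
  let ê : ℕ+ → H := fun r => if û r = 0 then 0 else e r
  have hspan : ∀ r, ρ r ∈ Submodule.span ℂ (û '' Set.Iic r) := fun r => by
    rw [span_gramSchmidtNormed, span_gramSchmidt_Iic]
    exact Submodule.subset_span ⟨r, Set.mem_Iic.2 le_rfl, rfl⟩
  have hûorth : ∀ r, û r ∈ (closedSpan f)ᗮ := fun r => by
    have h1 : û r ∈ Submodule.span ℂ (Set.range û) := Submodule.subset_span ⟨r, rfl⟩
    rw [span_gramSchmidtNormed_range, span_gramSchmidt] at h1
    exact Submodule.span_le.2 (by rintro _ ⟨r, rfl⟩; exact hρ r) h1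
  have hûû : ∀ {i j}, i ≠ j → inner ℂ (û i) (û j) = 0 := fun {i j} hij => by
    simp only [û, gramSchmidtNormed, inner_smul_left, inner_smul_right,
      gramSchmidt_orthogonal ℂ ρ hij, mul_zero]
  have hê_mem : ∀ j : ℕ+, ê j ∈ V j := fun j => by
    by_cases h0 : û j = 0
    · simp [ê, h0]
    · simpa [ê, h0] using he_mem j
  let A : κ ⊕ ℕ+ → L := Sum.elim f û
  let B : κ ⊕ ℕ+ → H := Sum.elim h ê
  have hAB : ∀ a b, inner ℂ (A a) (A b) = inner ℂ (B a) (B b) := by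
    rintro (a | i) (b | j)
    · exact hfh a b
    · exact (hûorth j _ (mem_closedSpan f a)).trans
        (hVorth (by positivity) (h_mem a) (hê_mem j)).symm
    · exact (Submodule.inner_left_of_mem_orthogonal (mem_closedSpan f b) (hûorth i)).trans
        (hVorth (by positivity) (hê_mem i) (h_mem b)).symm
    · change inner ℂ (û i) (û j) = inner ℂ (ê i) (ê j)
      by_cases hij : i = j
      · subst hij
        by_cases h0 : û i = 0
        · simp [ê, h0]
        · have h1 : ‖û i‖ = 1 := gramSchmidtNormed_unit_length' h0
          simp [ê, h0, inner_self_eq_norm_sq_to_K, h1, he_norm]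
      · rw [hûû hij, hVorth (fun h => hij (PNat.coe_injective h)) (hê_mem i) (hê_mem j)]
  obtain ⟨T, hT, hTiso⟩ := exists_isometry_of_gram A B hAB
  have hTf : ∀ k, T (f k) = h k := fun k => hT (Sum.inl k)
  have hTû : ∀ r, T (û r) = ê r := fun r => hT (Sum.inr r)
  have hfA : closedSpan f ≤ closedSpan A :=
    closedSpan_le (Submodule.isClosed_topologicalClosure _) fun k => mem_closedSpan A (Sum.inl k)
  have hu : ∀ r, u r = P (u r) + ρ r := fun r => by simp [ρ]
  have hρA : ∀ r, ρ r ∈ closedSpan A := fun r =>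
    Submodule.span_le.2 (by rintro _ ⟨j, -, rfl⟩; exact mem_closedSpan A (Sum.inr j)) (hspan r)
  have hTP : ∀ x ∈ closedSpan f, T x ∈ V 0 := fun x hx => by
    have hcl : IsClosed (((V 0).comap T.toLinearMap : Submodule ℂ L) : Set L) :=
      hV.complete_zero.isClosed.preimage T.continuous
    exact closedSpan_le hcl (fun k => by
      rw [Submodule.mem_comap]; exact (hTf k).symm ▸ h_mem k) hx
  have hTρ : ∀ r, T (ρ r) ∈ ⨆ j ∈ {j : ℕ+ | j ∈ {j | û j ≠ 0} ∧ j ≤ r}, V j := fun r => by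
    have h1 : Submodule.span ℂ (û '' Set.Iic r) ≤
        (⨆ j ∈ {j : ℕ+ | j ∈ {j | û j ≠ 0} ∧ j ≤ r}, V j).comap T.toLinearMap := by
      refine Submodule.span_le.2 ?_
      rintro _ ⟨j, hj, rfl⟩
      rw [SetLike.mem_coe, Submodule.mem_comap, ContinuousLinearMap.coe_coe, hTû]
      by_cases h0 : û j = 0
      · simp [ê, h0]
      · exact Submodule.mem_iSup_of_mem j (Submodule.mem_iSup_of_mem ⟨h0, hj⟩ (hê_mem j))
    exact h1 (hspan r)
  refine ⟨T, hTf, ⟨{j | û j ≠ 0}, fun r => ⟨?_, ?_⟩⟩, closedSpan A,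
    fun k => mem_closedSpan A (Sum.inl k), fun r => ?_, hTiso⟩
  · rw [hu r, map_add]
    exact Submodule.add_mem_sup (hTP _ (hP _)) (hTρ r)
  · rw [hu r, map_add, inner_add_right,
      hVorth (by positivity) (he_mem r) (hTP _ (hP _)), zero_add]
    -- If `û r = 0` then `r ∉ Λ`, and `T (ρ r)` has no component along `e r`. Otherwise `e r = T (û
    -- r)`, and the isometry reduces the claim to Gram–Schmidt in `L`.
    by_cases h0 : û r = 0
    · have h1 : (⨆ j ∈ {j : ℕ+ | j ∈ {j | û j ≠ 0} ∧ j ≤ r}, V j) ≤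
          LinearMap.ker (innerSL ℂ (e r)).toLinearMap := by
        refine iSup₂_le fun j hj x hx => ?_
        rw [LinearMap.mem_ker]
        refine hVorth (fun h => ?_) (he_mem r) hx
        exact hj.1 (PNat.coe_injective h ▸ h0)
      exact (show inner ℂ (e r) (T (ρ r)) = 0 from h1 (hTρ r)).ge
    · have h1 : e r = T (û r) := by rw [hTû]; simp [ê, h0]
      rw [h1, hTiso _ _ (hρA r)]
      exact inner_gramSchmidtNormed_self_nonneg ρ r
  · rw [hu r]
    exact add_mem (hfA (hP _)) (hρA r)

end Triangular

/-! ### From a solution to a family in the model space -/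

section Necessity

/-- These polynomials serve as integrable majorants of the extended monomials. -/
lemma IsSolution.integrable_mul_pow {s : ℕ → ℕ → ℂ} {μ : Measure (ℝ × ℝ)} (h : IsSolution s μ)
    (K M m n : ℕ) : Integrable (fun x : ℝ × ℝ =>
      ((x.1 : ℂ) ^ m * (1 + (x.1 : ℂ) ^ 2) ^ K) * ((x.2 : ℂ) ^ n * (1 + (x.2 : ℂ) ^ 2) ^ M)) μ := by
  induction M generalizing n with
  | zero =>
    simp only [pow_zero, mul_one]
    induction K generalizing m with
    | zero => simpa using (h m n).1
    | succ K ih =>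
      refine ((ih m).add (ih (m + 2))).congr (Filter.Eventually.of_forall fun x => ?_)
      simp only [Pi.add_apply]
      ring
  | succ M ih =>
    refine ((ih n).add (ih (n + 2))).congr (Filter.Eventually.of_forall fun x => ?_)
    simp only [Pi.add_apply]
    ring

/-- Since `1 ≤ ‖z‖ ≤ ‖z‖²`, the sign of the exponent can be ignored. -/
lemma norm_zpow_le_one_add_sq {x : ℝ} {z : ℂ} (hz : ‖z‖ ^ 2 = 1 + x ^ 2) (k : ℤ) :
    ‖z ^ k‖ ≤ (1 + x ^ 2) ^ k.natAbs := by
  have h1 : 1 ≤ ‖z‖ := by nlinarith [norm_nonneg z, sq_nonneg x]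
  calc ‖z ^ k‖ = ‖z‖ ^ k := norm_zpow _ _
    _ ≤ ‖z‖ ^ (k.natAbs : ℤ) := zpow_le_zpow_right₀ h1 (by omega)
    _ = ‖z‖ ^ k.natAbs := zpow_natCast _ _
    _ ≤ (1 + x ^ 2) ^ k.natAbs := by
      rw [← hz]
      exact pow_le_pow_left₀ (norm_nonneg _) (by nlinarith) _

lemma norm_ofReal_add_I_sq (x : ℝ) : ‖(x : ℂ) + I‖ ^ 2 = 1 + x ^ 2 := by
  rw [← normSq_eq_norm_sq, normSq_apply]; simp; ring

lemma norm_ofReal_sub_I_sq (x : ℝ) : ‖(x : ℂ) - I‖ ^ 2 = 1 + x ^ 2 := by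
  rw [← normSq_eq_norm_sq, normSq_apply]; simp; ring

lemma IsSolution.integrable_extMonomial {s : ℕ → ℕ → ℂ} {μ : Measure (ℝ × ℝ)}
    (h : IsSolution s μ) (a : Idx) : Integrable (extMonomial a) μ := by
  refine (h.integrable_mul_pow (a.k.natAbs + a.l.natAbs) (a.r.natAbs + a.t.natAbs) a.m a.n).mono
    (continuous_extMonomial a).aestronglyMeasurable (Filter.Eventually.of_forall fun x => ?_)
  have e : ∀ y : ℝ, ‖1 + (y : ℂ) ^ 2‖ = 1 + y ^ 2 := fun y => by
    rw [← Real.norm_of_nonneg (by positivity : 0 ≤ 1 + y ^ 2), ← Complex.norm_real]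
    push_cast
    rfl
  simp only [extMonomial, norm_mul, norm_pow, e, pow_add]
  calc _ ≤ ‖(x.1 : ℂ)‖ ^ a.m * (1 + x.1 ^ 2) ^ a.k.natAbs * (1 + x.1 ^ 2) ^ a.l.natAbs *
      ‖(x.2 : ℂ)‖ ^ a.n * (1 + x.2 ^ 2) ^ a.r.natAbs * (1 + x.2 ^ 2) ^ a.t.natAbs := by
        gcongr
        · exact norm_zpow_le_one_add_sq (norm_ofReal_add_I_sq _) _
        · exact norm_zpow_le_one_add_sq (norm_ofReal_sub_I_sq _) _
        · exact norm_zpow_le_one_add_sq (norm_ofReal_add_I_sq _) _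
        · exact norm_zpow_le_one_add_sq (norm_ofReal_sub_I_sq _) _
    _ = _ := by ring

/-- The squared modulus of an extended monomial is the modulus of another one. -/
lemma IsSolution.memLp_extMonomial {s : ℕ → ℕ → ℂ} {μ : Measure (ℝ × ℝ)}
    (h : IsSolution s μ) (a : Idx) : MemLp (extMonomial a) 2 μ := by
  rw [memLp_two_iff_integrable_sq_norm (continuous_extMonomial a).aestronglyMeasurable]
  refine (h.integrable_extMonomial (sumIdx a a)).norm.congr (Filter.Eventually.of_forall fun x => ?_)
  simp only [← extMonomial_mul_conj, norm_mul, RCLike.norm_conj, sq]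

variable {H : Type*} [NormedAddCommGroup H] [InnerProductSpace ℂ H]

/-- A solution of the extended problem solves the moment problem. -/
lemma IsExtSolution.isSolution {s : ℕ → ℕ → ℂ} {h : ℕ → ℕ → H} (h_rep : Represents s h)
    {g : Idx → H} {φ : Idx → ℂ} (hgh : Extends h g) (hg : HasGram g φ)
    {μ : Measure (ℝ × ℝ)} (hμ : IsExtSolution φ μ) : IsSolution s μ := by
  intro m n
  have e : extMonomial ⟨m, 0, 0, n, 0, 0⟩ = fun x => (x.1 : ℂ) ^ m * (x.2 : ℂ) ^ n := by
    funext x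
    simp [extMonomial]
  have h1 := hμ ⟨m, 0, 0, n, 0, 0⟩
  rw [e, hg.apply_eq_inner, hgh, hgh, h_rep] at h1
  exact h1

variable [CompleteSpace H]

/-- A solution of the moment problem gives rise to a family with all required properties. -/
lemma IsSolution.exists_family {s : ℕ → ℕ → ℂ} {μ : Measure (ℝ × ℝ)} (hμ : IsSolution s μ)
    {V : ℕ → Submodule ℂ H} (hV : IsModelSpace V)
    {h : ℕ → ℕ → H} (h_mem : ∀ m n, h m n ∈ V 0) (h_rep : Represents s h)
    {e : ℕ+ → H} (he_mem : ∀ j : ℕ+, e j ∈ V j) (he_norm : ∀ j : ℕ+, ‖e j‖ = 1)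
    (w : ℕ+ ≃ (Omega0ᶜ : Set Idx)) :
    ∃ g : Idx → H, Extends h g ∧ IsTriangular V e w g ∧ ShiftRelations g ∧
      ∃ φ : Idx → ℂ, HasGram g φ := by
  let F : Idx → Lp ℂ 2 μ := fun a => (hμ.memLp_extMonomial a).toLp (extMonomial a)
  have hF : ∀ a b, inner ℂ (F b) (F a) = ∫ x, extMonomial (sumIdx a b) x ∂μ := fun a b => by
    rw [L2.inner_def]
    refine integral_congr_ae ?_
    filter_upwards [(hμ.memLp_extMonomial a).coeFn_toLp, (hμ.memLp_extMonomial b).coeFn_toLp]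
      with x hx hy
    simp only [F, hx, hy, RCLike.inner_apply, extMonomial_mul_conj]
  have hshift : ∀ {a b c : Idx} {z : ℂ},
      (∀ x, extMonomial c x = extMonomial a x + z * extMonomial b x) → F c = F a + z • F b := by
    intro a b c z hx
    simp only [F]
    rw [← MemLp.toLp_const_smul, ← MemLp.toLp_add]
    exact MemLp.toLp_congr _ _ (Filter.Eventually.of_forall hx)
  have hgram : ∀ p q : ℕ × ℕ, inner ℂ (F ⟨p.1, 0, 0, p.2, 0, 0⟩) (F ⟨q.1, 0, 0, q.2, 0, 0⟩) =
      inner ℂ (h p.1 p.2) (h q.1 q.2) := fun p q => by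
    rw [hF, h_rep, ← (hμ _ _).2]
    simp [extMonomial, sumIdx]
  obtain ⟨T, hT, hΛ, K, hK1, hK2, hiso⟩ := exists_triangular hV he_mem he_norm
    (fun p : ℕ × ℕ => F ⟨p.1, 0, 0, p.2, 0, 0⟩) (fun p => h p.1 p.2) (fun p => h_mem _ _) hgram
    (fun r => F (w r))
  -- Every index lies in `Omega0` or in the range of `w`, so `T` preserves all inner products of the
  -- family.
  have hK : ∀ a, F a ∈ K := fun a => by
    by_cases ha : a ∈ Omega0
    · obtain ⟨h1, h2, h3, h4⟩ := ha
      have : a = ⟨a.m, 0, 0, a.n, 0, 0⟩ := Idx.ext rfl h1 h2 rfl h3 h4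
      rw [this]
      exact hK1 (a.m, a.n)
    · have := hK2 (w.symm ⟨a, ha⟩)
      simpa using this
  refine ⟨fun a => T (F a), fun m n => hT (m, n), hΛ, ⟨?_, ?_, ?_, ?_⟩,
    fun c => ∫ x, extMonomial c x ∂μ, fun a b => ?_⟩
  · intro m k l n r t
    rw [← map_smul, ← map_add, ← hshift (c := ⟨m, k + 1, l, n, r, t⟩)]
    intro x
    simp only [extMonomial, zpow_add_one₀ (ofReal_add_I_ne_zero _), pow_succ]
    ring
  · intro m k l n r t
    rw [sub_eq_add_neg, ← neg_smul, ← map_smul, ← map_add,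
      ← hshift (c := ⟨m, k, l + 1, n, r, t⟩)]
    intro x
    simp only [extMonomial, zpow_add_one₀ (ofReal_sub_I_ne_zero _), pow_succ]
    ring
  · intro m k l n r t
    rw [← map_smul, ← map_add, ← hshift (c := ⟨m, k, l, n, r + 1, t⟩)]
    intro x
    simp only [extMonomial, zpow_add_one₀ (ofReal_add_I_ne_zero _), pow_succ]
    ring
  · intro m k l n r t
    rw [sub_eq_add_neg, ← neg_smul, ← map_smul, ← map_add,
      ← hshift (c := ⟨m, k, l, n, r, t + 1⟩)]
    intro x
    simp only [extMonomial, zpow_add_one₀ (ofReal_sub_I_ne_zero _), pow_succ]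
    ring
  · rw [hiso _ _ (hK a), hF]

end Necessity

end TwoDimMoment

end

theorem theorem3p2
    (s : ℕ → ℕ → ℂ) (hs : IsPositive s)
    {H : Type*} [NormedAddCommGroup H] [InnerProductSpace ℂ H] [CompleteSpace H]
    (V : ℕ → Submodule ℂ H) (hV : IsModelSpace V)
    (h : ℕ → ℕ → H) (h_mem : ∀ m n, h m n ∈ V 0) (h_rep : Represents s h)
    (e : ℕ+ → H) (he_mem : ∀ j : ℕ+, e j ∈ V j) (he_norm : ∀ j : ℕ+, ‖e j‖ = 1)
    (w : ℕ+ ≃ (Omega0ᶜ : Set Idx)) :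
    ((∃ μ : MeasureTheory.Measure (ℝ × ℝ), IsSolution s μ) ↔
      ∃ g : Idx → H, Extends h g ∧ IsTriangular V e w g ∧ ShiftRelations g ∧
        ∃ φ : Idx → ℂ, HasGram g φ) ∧
    (∀ (g : Idx → H) (φ : Idx → ℂ),
      Extends h g → IsTriangular V e w g → ShiftRelations g → HasGram g φ →
        (∃! μ : MeasureTheory.Measure (ℝ × ℝ), IsExtSolution φ μ) ∧
        ∀ μ : MeasureTheory.Measure (ℝ × ℝ), IsExtSolution φ μ → IsSolution s μ) := by
  refine ⟨⟨?_, ?_⟩, ?_⟩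
  · rintro ⟨μ, hμ⟩
    exact hμ.exists_family hV h_mem h_rep he_mem he_norm w
  · rintro ⟨g, hgh, -, hgs, φ, hg⟩
    obtain ⟨μ, hμ⟩ := exists_isExtSolution hgs hg
    exact ⟨μ, hμ.isSolution h_rep hgh hg⟩
  · intro g φ hgh _ hgs hg
    obtain ⟨μ, hμ⟩ := exists_isExtSolution hgs hg
    exact ⟨⟨μ, hμ, fun μ' hμ' => hμ'.unique hμ⟩, fun μ' hμ' => hμ'.isSolution h_rep hgh hg⟩
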